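/- Let $m \ge 3$ be an odd integer, let $d = 2m$, and let $K$ be a totally ramified finite extension of $\mathbb{Q}_2$, i.e. a finite extension whose ramification index equals its degree $[K:\mathbb{Q}_2]$. Then for every integer $s \ge \frac{d^2}{4} + 3d + 1$ and all $a_1, \dots, a_s \in K$, the additive (diagonal) form $$a_1x_1^d + a_2x_2^d + \cdots + a_sx_s^d$$ has a nontrivial zero, that is, there is $(x_1,\dots,x_s) \in K^s \setminus \{0\}$ at which it vanishes. Equivalently, if $\Gamma^*(d,K)$ denotes the least number $N$ such that every additive form of degree $d$ over $K$ in at least $N$ variables has a nontrivial zero, then $\Gamma^*(d,K)$ is finite and $$\Gamma^*(d,K) \le \frac{d^2}{4} + 3d + 1.$$ This bound is strictly smaller than $d^2 + 1$, the bound for $\Gamma^*(d,K)$ in the refinement of Artin's conjecture. -/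

import Mathlib

/-- The diagonal (additive) form `a₁x₁ᵈ + ⋯ + aₛxₛᵈ` over `K` has a nontrivial zero in `Kˢ`. -/
def HasNontrivialZero {K : Type*} [Field K] (d : ℕ) {s : ℕ} (a : Fin s → K) : Prop :=
  ∃ x : Fin s → K, x ≠ 0 ∧ ∑ i, a i * x i ^ d = 0

/-- `Γ*(d, K)`: the least `N` such that every additive form of degree `d` over `K` in at least
`N` variables has a nontrivial zero. It is `⊤` if there is no such natural number. -/
noncomputable def gammaStar (d : ℕ) (K : Type*) [Field K] : ℕ∞ :=
  ⨅ N ∈ {N : ℕ | ∀ s : ℕ, N ≤ s → ∀ a : Fin s → K, HasNontrivialZero d a}, (N : ℕ∞)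

/-- A finite extension `K / ℚ_p` is totally ramified if the ramification index over `ℤ_p` of the
maximal ideal `P` of its ring of integers (the integral closure of `ℤ_p` in `K`, which is a local
ring) is equal to the degree `[K : ℚ_p]`. -/
def IsTotallyRamified (p : ℕ) [Fact p.Prime] (K : Type*) [Field K] [Algebra ℚ_[p] K]
    [Algebra ℤ_[p] K] : Prop :=
  ∃ P : Ideal (integralClosure ℤ_[p] K),
    P.IsMaximal ∧ P.ramificationIdx ℤ_[p] = Module.finrank ℚ_[p] K

/-! Say that an element has level `l` when its valuation is `exp (-l)`, and let `2` have level `e`.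
Total ramification makes the residue field `𝔽₂`, so every unit is an `m`-th power for odd `m`, and
the `d`-th powers of units are exactly the squares of units. Elements agreeing with `1` beyond level
`2e` are `d`-th powers, so a value of the form lying more than `2e` levels above one of its terms
yields a zero (`Represents.perturb`).

Two variables of equal level `l` are either full, reaching level `l + 2e`, or half, approximating
everything of some level `l + f` (`isFull_or_isHalf_pair`). Disjoint half pairs aiming at the same
level modulo `d` give a zero if their own levels differ, and a full set if they coincide. A full set
gives a zero together with a second one at its level, or with a variable outside it at level `l +
2e` modulo `d`.

Hence, without a zero, the targets of different levels are disjoint subsets of `ZMod d`, and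
pigeonhole bounds the variables per level. Summing leaves at most `9d/2` variables, which is less
than the stated bound for `m ≥ 3`. -/

open scoped WithZero

/-! ### Completeness and Hensel's lemma at the ideal `(2)`. -/

theorem AdicCompletion.isAdicComplete_of_finite {R M : Type*} [CommRing R] [IsNoetherianRing R]
    [IsLocalRing R] [IsAdicComplete (IsLocalRing.maximalIdeal R) R] [AddCommGroup M] [Module R M]
    [Module.Finite R M] : IsAdicComplete (IsLocalRing.maximalIdeal R) M := by
  set I := IsLocalRing.maximalIdeal R
  rw [← AdicCompletion.of_bijective_iff]
  have hH : IsHausdorff I M := IsHausdorff.of_le_jacobson _ _ (IsAdicComplete.le_jacobson_bot _)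
  refine ⟨AdicCompletion.of_injective I M, fun y => ?_⟩
  obtain ⟨t, rfl⟩ := AdicCompletion.ofTensorProduct_surjective_of_finite I M y
  induction t with
  | zero => exact ⟨0, by simp⟩
  | add s t hs ht =>
    obtain ⟨x, hx⟩ := hs
    obtain ⟨y, hy⟩ := ht
    exact ⟨x + y, by simp [hx, hy]⟩
  | tmul r x =>
    obtain ⟨r, rfl⟩ := (AdicCompletion.of_bijective_iff (I := I) (M := R)).2 inferInstance |>.2 r
    refine ⟨r • x, ?_⟩
    rw [AdicCompletion.ofTensorProduct_tmul]
    ext n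
    rfl

namespace HenselianRing
variable {R : Type*} [CommRing R] [HenselianRing R (Ideal.span {(2 : R)})]

theorem exists_sq_add_self_eq {k : R} {N : ℕ} (hk : (2 : R) ∣ k ^ 2 ^ N) : ∃ y, y ^ 2 + y = k := by
  -- Modulo `2` the sum `k + k² + k⁴ + ⋯` telescopes under `a ↦ a² + a`. It is an approximate root
  -- with derivative `2a + 1`, a unit modulo `2`.
  have key : ∀ n : ℕ, ∃ a : R, (2 : R) ∣ a ^ 2 + a - (k + k ^ 2 ^ n) := by
    intro n
    induction n with
    | zero => exact ⟨0, -k, by ring⟩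
    | succ n ih =>
      obtain ⟨a, b, hb⟩ := ih
      refine ⟨a + k ^ 2 ^ n, b + a * k ^ 2 ^ n + k ^ 2 ^ n, ?_⟩
      have h2 : k ^ 2 ^ (n + 1) = (k ^ 2 ^ n) ^ 2 := by rw [← pow_mul, pow_succ]
      rw [h2]
      linear_combination hb
  obtain ⟨a, ha⟩ := key N
  have ha' : (2 : R) ∣ a ^ 2 + a - k := by
    have := dvd_add ha hk
    ring_nf at this ⊢
    exact this
  obtain ⟨y, hy, -⟩ := is_henselian (I := Ideal.span {(2 : R)})
    (Polynomial.X ^ 2 + Polynomial.X - Polynomial.C k)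
    (by monicity!) a (by simpa [Ideal.mem_span_singleton] using ha') (by
      have h : Ideal.Quotient.mk (Ideal.span {(2 : R)}) (2 * a) = 0 :=
        Ideal.Quotient.eq_zero_iff_mem.2 (Ideal.mem_span_singleton.2 (dvd_mul_right _ _))
      have h' : (Polynomial.X ^ 2 + Polynomial.X - Polynomial.C k).derivative.eval a = 2 * a + 1 := by
        simp [one_add_one_eq_two]
      rw [h', map_add, h, zero_add, map_one]
      exact isUnit_one)
  refine ⟨y, ?_⟩
  have : y ^ 2 + y - k = 0 := by simpa [Polynomial.IsRoot] using hy
  linear_combination this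

/-- Frobenius modulo `2` gives `u ^ 2 ^ N ≡ 1`. With `k` inverse to `m` modulo `2 ^ N`, the power `u
^ k` is an approximate `m`-th root, which lifts because `m` is odd. -/
theorem exists_pow_eq_of_odd {u : R} (hu : IsUnit u) {N : ℕ} (h : (2 : R) ∣ (u - 1) ^ 2 ^ N)
    {m : ℕ} (hm : Odd m) : ∃ y, y ^ m = u := by
  set I := Ideal.span {(2 : R)}
  have h0 : Ideal.Quotient.mk I 2 = 0 :=
    Ideal.Quotient.eq_zero_iff_mem.2 (Ideal.mem_span_singleton_self _)
  have key : ∀ n : ℕ, (2 : R) ∣ u ^ 2 ^ n - 1 - (u - 1) ^ 2 ^ n := by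
    intro n
    induction n with
    | zero => simp
    | succ n ih =>
      obtain ⟨b, hb⟩ := ih
      have h1 : u ^ 2 ^ (n + 1) = (u ^ 2 ^ n) ^ 2 := by rw [← pow_mul, pow_succ]
      have h2 : (u - 1) ^ 2 ^ (n + 1) = ((u - 1) ^ 2 ^ n) ^ 2 := by rw [← pow_mul, pow_succ]
      refine ⟨b * (u ^ 2 ^ n - 1 + (u - 1) ^ 2 ^ n) + u ^ 2 ^ n - 1, ?_⟩
      rw [h1, h2]
      linear_combination (u ^ 2 ^ n - 1 + (u - 1) ^ 2 ^ n) * hb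
  have hN : (2 : R) ∣ u ^ 2 ^ N - 1 := by simpa using dvd_add (key N) h
  have hcop : Nat.Coprime m (2 ^ N) := (Nat.coprime_two_right.2 hm).pow_right N
  obtain ⟨k, j, hkj⟩ : ∃ k j : ℕ, m * k = 1 + 2 ^ N * j := by
    rcases Nat.eq_zero_or_pos N with rfl | hNpos
    · obtain ⟨j, rfl⟩ : ∃ j, m = 1 + j := ⟨m - 1, by have := hm.pos; omega⟩
      exact ⟨1, j, by simp⟩
    · obtain ⟨k, hk⟩ := Nat.exists_mul_mod_eq_one_of_coprime hcop (Nat.one_lt_two_pow hNpos.ne')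
      refine ⟨k, m * k / 2 ^ N, ?_⟩
      conv_lhs => rw [← Nat.mod_add_div (m * k) (2 ^ N), hk.2]
  obtain ⟨y, hy, -⟩ := is_henselian (I := I) (Polynomial.X ^ m - Polynomial.C u)
    (Polynomial.monic_X_pow_sub_C u hm.pos.ne') (u ^ k) (by
      have h1 : u ^ 2 ^ N - 1 ∣ (u ^ 2 ^ N) ^ j - 1 := sub_one_dvd_pow_sub_one _ _
      have h2 : (u ^ k) ^ m - u = u * ((u ^ 2 ^ N) ^ j - 1) := by
        rw [← pow_mul, mul_comm k m, hkj, pow_add, pow_mul]; ring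
      simp only [Polynomial.eval_sub, Polynomial.eval_pow, Polynomial.eval_X, Polynomial.eval_C]
      rw [Ideal.mem_span_singleton, h2]
      exact (hN.trans h1).mul_left _) (by
      have hm1 : Ideal.Quotient.mk I (m : R) = 1 := by
        obtain ⟨t, rfl⟩ := hm
        simp only [Nat.cast_add, Nat.cast_mul, Nat.cast_ofNat, map_add, map_mul, h0]
        simp
      simp only [Polynomial.derivative_sub, Polynomial.derivative_X_pow, Polynomial.derivative_C,
        sub_zero, Polynomial.eval_mul, Polynomial.eval_pow, Polynomial.eval_X,
        map_mul, Polynomial.eval_natCast, map_natCast] at hm1 ⊢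
      rw [hm1, one_mul]
      exact ((hu.pow _).pow _).map _)
  refine ⟨y, ?_⟩
  have : y ^ m - u = 0 := by simpa [Polynomial.IsRoot] using hy
  linear_combination this

end HenselianRing

/-! ### The ring of integers of a totally ramified extension of `ℚ_[2]`. -/

theorem Ideal.exists_algebraMap_sub_mem {R S : Type*} [CommRing R] [CommRing S] [Algebra R S]
    (p : Ideal R) (P : Ideal S) [p.IsMaximal] [P.IsMaximal] [P.LiesOver p]
    (h : P.inertiaDeg R = 1) (x : S) : ∃ c, algebraMap R S c - x ∈ P := by
  rw [Ideal.inertiaDeg_eq_of_isMaximal p P] at h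
  let : Field (R ⧸ p) := Ideal.Quotient.field p
  obtain ⟨c, hc⟩ := (finrank_eq_one_iff_of_nonzero' (1 : S ⧸ P) one_ne_zero).1 h
    (Ideal.Quotient.mk P x)
  obtain ⟨c, rfl⟩ := Ideal.Quotient.mk_surjective c
  refine ⟨c, ?_⟩
  rw [← Ideal.Quotient.eq, ← hc, Algebra.smul_def, mul_one]
  rfl

section
variable {K : Type*} [Field K] [Algebra ℚ_[2] K] [FiniteDimensional ℚ_[2] K]
    [Algebra ℤ_[2] K] [IsScalarTower ℤ_[2] ℚ_[2] K]

theorem finite_integralClosure_padicInt : Module.Finite ℤ_[2] (integralClosure ℤ_[2] K) :=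
  IsIntegralClosure.finite ℤ_[2] ℚ_[2] K _

theorem isDedekindDomain_integralClosure_padicInt : IsDedekindDomain (integralClosure ℤ_[2] K) :=
  IsIntegralClosure.isDedekindDomain ℤ_[2] ℚ_[2] K _

theorem isFractionRing_integralClosure_padicInt : IsFractionRing (integralClosure ℤ_[2] K) K :=
  IsIntegralClosure.isFractionRing_of_finite_extension ℤ_[2] ℚ_[2] K _

omit [FiniteDimensional ℚ_[2] K] in
theorem faithfulSMul_padicInt : FaithfulSMul ℤ_[2] K := by
  rw [faithfulSMul_iff_algebraMap_injective, IsScalarTower.algebraMap_eq ℤ_[2] ℚ_[2] K]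
  exact (algebraMap ℚ_[2] K).injective.comp (IsFractionRing.injective _ _)

theorem finrank_integralClosure_padicInt :
    Module.finrank ℤ_[2] (integralClosure ℤ_[2] K) = Module.finrank ℚ_[2] K := by
  have := isFractionRing_integralClosure_padicInt (K := K)
  have := finite_integralClosure_padicInt (K := K)
  have := faithfulSMul_padicInt (K := K)
  exact (IsFractionRing.finrank_eq ℤ_[2] ℚ_[2] (integralClosure ℤ_[2] K) K).symm

theorem henselianRing_integralClosure_padicInt :
    HenselianRing (integralClosure ℤ_[2] K) (Ideal.span {(2 : integralClosure ℤ_[2] K)}) := by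
  have := finite_integralClosure_padicInt (K := K)
  have h : IsAdicComplete (IsLocalRing.maximalIdeal ℤ_[2]) (integralClosure ℤ_[2] K) :=
    AdicCompletion.isAdicComplete_of_finite
  have hI : (Ideal.span {2} : Ideal (integralClosure ℤ_[2] K)) =
      (IsLocalRing.maximalIdeal ℤ_[2]).map (algebraMap ℤ_[2] (integralClosure ℤ_[2] K)) := by
    rw [PadicInt.maximalIdeal_eq_span_p, Ideal.map_span]
    simp only [Set.image_singleton, Nat.cast_ofNat, map_ofNat]
  have : IsAdicComplete (Ideal.span {(2 : integralClosure ℤ_[2] K)}) (integralClosure ℤ_[2] K) := by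
    rw [hI, isAdicComplete_iff, IsHausdorff.map_algebraMap_iff, IsPrecomplete.map_algebraMap_iff]
    exact (isAdicComplete_iff _ _).1 h
  infer_instance

/-- In `∑ eᵢfᵢ = [K : ℚ₂]` the ramification index of `P` already exhausts the right side, so no
other prime exists and `P` has inertia degree `1`. -/
theorem IsTotallyRamified.exists_prime (hK : IsTotallyRamified 2 K) :
    ∃ P : Ideal (integralClosure ℤ_[2] K), P.IsMaximal ∧ 2 ∈ P ∧
      (∀ Q : Ideal _, Q.IsMaximal → Q = P) ∧
      ∀ x, x ∈ P ∨ x - 1 ∈ P := by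
  set O := integralClosure ℤ_[2] K
  obtain ⟨P, hP, hram⟩ : ∃ P : Ideal O,
    P.IsMaximal ∧ P.ramificationIdx ℤ_[2] = Module.finrank ℚ_[2] K := hK
  have := isFractionRing_integralClosure_padicInt (K := K)
  have := finite_integralClosure_padicInt (K := K)
  have := isDedekindDomain_integralClosure_padicInt (K := K)
  have := faithfulSMul_padicInt (K := K)
  set p := IsLocalRing.maximalIdeal ℤ_[2]
  have hover : ∀ Q : Ideal O, Q.IsMaximal → Q.LiesOver p := fun Q hQ => by
    have : (Q.under ℤ_[2]).IsMaximal := Ideal.IsMaximal.under ℤ_[2] Q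
    exact ⟨(IsLocalRing.eq_maximalIdeal this).symm⟩
  have hPp := hover P hP
  have h2 : (2 : O) ∈ P := by
    have : (2 : ℤ_[2]) ∈ p := by
      have h := Ideal.mem_span_singleton_self ((2 : ℕ) : ℤ_[2])
      rwa [← PadicInt.maximalIdeal_eq_span_p] at h
    rw [hPp.over, Ideal.mem_comap, map_ofNat] at this
    exact this
  have hfin : (p.primesOver O).Finite := Algebra.QuasiFinite.finite_primesOver p
  let := hfin.fintype
  have hsum := Ideal.sum_ramification_inertia_eq_finrank p O
  rw [finrank_integralClosure_padicInt, ← hram] at hsum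
  have hpos : ∀ q : p.primesOver O, 0 < q.1.ramificationIdx ℤ_[2] * q.1.inertiaDeg ℤ_[2] := fun q => by
    have := q.2.1
    exact Nat.mul_pos (Ideal.ramificationIdx_pos _ _) (Ideal.inertiaDeg_pos _ _)
  let P' : p.primesOver O := ⟨P, hP.isPrime, hPp⟩
  have hPr : 0 < P.ramificationIdx ℤ_[2] := Ideal.ramificationIdx_pos _ _
  have hPi : 0 < P.inertiaDeg ℤ_[2] := Ideal.inertiaDeg_pos _ _
  classical
  rw [← Finset.add_sum_erase _ _ (Finset.mem_univ P')] at hsum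
  change P.ramificationIdx ℤ_[2] * P.inertiaDeg ℤ_[2] + _ = _ at hsum
  have hle : P.ramificationIdx ℤ_[2] ≤ P.ramificationIdx ℤ_[2] * P.inertiaDeg ℤ_[2] :=
    Nat.le_mul_of_pos_right _ hPi
  have hrest : ∑ q ∈ Finset.univ.erase P', q.1.ramificationIdx ℤ_[2] * q.1.inertiaDeg ℤ_[2] = 0 := by
    omega
  have hdeg : P.inertiaDeg ℤ_[2] = 1 := by
    rw [hrest, add_zero] at hsum
    exact Nat.eq_of_mul_eq_mul_left hPr (by omega)
  refine ⟨P, hP, h2, fun Q hQ => ?_, fun x => ?_⟩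
  · by_contra hne
    have hQ' : (⟨Q, hQ.isPrime, hover Q hQ⟩ : p.primesOver O) ∈ Finset.univ.erase P' := by
      simp only [Finset.mem_erase, Finset.mem_univ, and_true]
      exact fun h => hne (congrArg Subtype.val h)
    have := Finset.sum_eq_zero_iff.1 hrest _ hQ'
    exact (hpos _).ne' this
  · obtain ⟨c, hcx⟩ := Ideal.exists_algebraMap_sub_mem p P hdeg x
    have hcp : ∀ z ∈ p, algebraMap ℤ_[2] O z ∈ P := fun z hz => by
      rw [hPp.over] at hz
      exact hz
    have hc01 : c ∈ p ∨ c - 1 ∈ p := by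
      have h := PadicInt.exists_mem_range (p := 2) c
      obtain ⟨n, hn, hcn⟩ := h
      interval_cases n
      · left; simpa [p] using hcn
      · right; simpa [p] using hcn
    rcases hc01 with h | h
    · left
      have := P.sub_mem (hcp _ h) hcx
      simpa using this
    · right
      have := P.sub_mem (hcp _ h) hcx
      simpa using this

theorem IsTotallyRamified.exists_valuation (hK : IsTotallyRamified 2 K) :
    ∃ v : Valuation K ℤᵐ⁰, (∃ π, v π = WithZero.exp (-1)) ∧ (∀ x, v x = 1 → v (x - 1) < 1) ∧
      (∀ x, v (x - 1) < v 4 → ∃ y, y ^ 2 = x) ∧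
      ∀ m : ℕ, Odd m → ∀ x, v x = 1 → ∃ y, y ^ m = x := by
  have := isFractionRing_integralClosure_padicInt (K := K)
  have := isDedekindDomain_integralClosure_padicInt (K := K)
  have := henselianRing_integralClosure_padicInt (K := K)
  set O := integralClosure ℤ_[2] K
  obtain ⟨P, hP, h2, huniq, hres⟩ : ∃ P : Ideal O, P.IsMaximal ∧ 2 ∈ P ∧
    (∀ Q : Ideal O, Q.IsMaximal → Q = P) ∧ ∀ x, x ∈ P ∨ x - 1 ∈ P := hK.exists_prime
  have : CharZero K := charZero_of_injective_algebraMap (algebraMap ℚ_[2] K).injective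
  have hO2 : (2 : O) ≠ 0 := fun h => by
    have := congrArg (algebraMap O K) h
    simp at this
  let w : IsDedekindDomain.HeightOneSpectrum O :=
    ⟨P, hP.isPrime, fun h => hO2 (by simpa only [h, Ideal.mem_bot] using h2)⟩
  have hw : ∀ w' : IsDedekindDomain.HeightOneSpectrum O, w' = w := fun w' =>
    IsDedekindDomain.HeightOneSpectrum.ext (huniq _ w'.isMaximal)
  have hint : ∀ x : K, w.valuation K x ≤ 1 → ∃ y : O, algebraMap O K y = x := fun x hx =>
    IsDedekindDomain.HeightOneSpectrum.mem_integers_of_valuation_le_one K x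
      (fun w' => by rwa [hw w'])
  -- `P` is the only nonzero prime, hence the radical of `(2)`; this supplies the divisibility
  -- needed for Hensel's lemma at `(2)`.
  have hnil : ∀ k ∈ P, ∃ N : ℕ, (2 : O) ∣ k ^ 2 ^ N := by
    intro k hk
    have hrad : k ∈ (Ideal.span {(2 : O)}).radical := by
      rw [Ideal.radical_eq_sInf, Ideal.mem_sInf]
      rintro Q ⟨hQ, hQp⟩
      have : Q.IsMaximal := hQp.isMaximal (fun h => hO2 (by
        simpa [h] using hQ (Ideal.mem_span_singleton_self 2)))
      rwa [huniq Q this]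
    obtain ⟨n, hn⟩ := hrad
    refine ⟨n, (Ideal.mem_span_singleton.1 hn).trans (pow_dvd_pow _ Nat.lt_two_pow_self.le)⟩
  have hlt : ∀ x : O, w.valuation K (algebraMap O K x) < 1 ↔ x ∈ P := fun x =>
    w.valuation_lt_one_iff_mem x
  refine ⟨w.valuation K, w.valuation_exists_uniformizer K, ?_, ?_, ?_⟩
  · intro x hx
    obtain ⟨y, rfl⟩ := hint x hx.le
    rcases hres y with h | h
    · exact absurd hx ((hlt y).2 h).ne
    · simpa using (hlt _).2 h
  · intro x hx
    have h4 : w.valuation K (4 : K) ≠ 0 := by simp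
    have hx4 : w.valuation K ((x - 1) / 4) < 1 := by
      rw [map_div₀]
      exact (div_lt_one₀ (zero_lt_iff.2 h4)).2 hx
    obtain ⟨k, hk⟩ := hint _ hx4.le
    obtain ⟨N, hN⟩ := hnil k ((hlt k).1 (hk ▸ hx4))
    obtain ⟨y, hy⟩ := HenselianRing.exists_sq_add_self_eq hN
    -- If `x = 1 + 4k` and `y² + y = k`, then `(1 + 2y)² = x`.
    refine ⟨1 + 2 * algebraMap O K y, ?_⟩
    have := congrArg (algebraMap O K) hy
    rw [hk] at this
    simp only [map_add, map_pow] at this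
    field_simp at this
    linear_combination this
  · intro m hm x hx
    obtain ⟨u, rfl⟩ := hint x hx.le
    have hu : IsUnit u := by
      by_contra hu
      obtain ⟨Q, hQ, huQ⟩ := exists_max_ideal_of_mem_nonunits hu
      rw [huniq Q hQ, ← hlt] at huQ
      exact huQ.ne hx
    obtain ⟨N, hN⟩ := hnil (u - 1) ((hres u).resolve_left fun h => ((hlt u).2 h).ne hx)
    obtain ⟨y, hy⟩ := HenselianRing.exists_pow_eq_of_odd hu hN hm
    exact ⟨algebraMap O K y, by rw [← map_pow, hy]⟩
end
-- Arithmetic of levels for a dyadic valuation.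
open WithZero (exp)

/-- `v` is a discrete valuation with uniformizer `π` and residue field `𝔽₂`, for which `2` has
level `e`, squares of units are `d`-th powers and elements close to `1` are `d`-th powers. -/
structure IsDyadic {K : Type*} [Field K] (v : Valuation K ℤᵐ⁰) (π : K) (e d : ℕ) : Prop where
  unif : v π = exp (-1)
  res : ∀ x, v x = 1 → v (x - 1) < 1
  two : v 2 = exp (-(e : ℤ))
  sq : ∀ x, v x = 1 → ∃ y, y ^ d = x ^ 2
  near_one : ∀ x, v (x - 1) < exp (-(2 * e : ℤ)) → ∃ y, y ^ d = x

theorem WithZero.lt_exp_iff_le_exp_sub_one {a : ℤᵐ⁰} {n : ℤ} : a < exp n ↔ a ≤ exp (n - 1) := by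
  induction a using WithZero.expRecOn with
  | zero => simp
  | exp k => rw [WithZero.exp_lt_exp, WithZero.exp_le_exp, Int.le_sub_one_iff]

namespace IsDyadic
variable {K : Type*} [Field K] {v : Valuation K ℤᵐ⁰} {π : K} {e d : ℕ}

theorem pi_ne_zero (h : IsDyadic v π e d) : π ≠ 0 := by
  rintro rfl
  exact WithZero.exp_ne_zero ((map_zero v).symm.trans h.unif).symm

theorem map_zpow (h : IsDyadic v π e d) (n : ℤ) : v (π ^ n) = exp (-n) := by
  rw [map_zpow₀, h.unif, ← WithZero.exp_zsmul]
  simp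

/-- Over `𝔽₂` there is only one nonzero leading coefficient, so equal levels always cancel. -/
theorem map_sub_lt (h : IsDyadic v π e d) {x y : K} {n : ℤ} (hx : v x = exp n) (hy : v y = exp n) :
    v (x - y) < exp n := by
  have hy0 : y ≠ 0 := by rintro rfl; exact WithZero.exp_ne_zero ((map_zero v).symm.trans hy).symm
  have h1 : v (x / y) = 1 := by rw [map_div₀, hx, hy]; simp
  have h2 := h.res _ h1
  have h3 : x - y = (x / y - 1) * y := by field_simp
  rw [h3, map_mul, hy]
  exact mul_lt_of_lt_one_left (by simp) h2

theorem map_add_lt (h : IsDyadic v π e d) {x y : K} {n : ℤ} (hx : v x = exp n) (hy : v y = exp n) :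
    v (x + y) < exp n := by
  rw [← sub_neg_eq_add]
  exact h.map_sub_lt hx (by rwa [Valuation.map_neg])

theorem one_le (h : IsDyadic v π e d) : 0 < e := by
  have h1 : v (1 + 1) < exp 0 := h.map_add_lt (by simp) (by simp)
  rw [one_add_one_eq_two, h.two, WithZero.exp_lt_exp] at h1
  omega

/-- Squares of the units `1 + πʲ` with `0 < j < e` differ from `1` by an element of level `2j`. -/
theorem map_one_add_sq_sub_one (h : IsDyadic v π e d) {j : ℕ} (hj : j < e) :
    v ((1 + π ^ j) ^ 2 - 1) = exp (-(2 * j : ℤ)) := by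
  have hp := h.map_zpow j
  rw [zpow_natCast] at hp
  have h1 : (1 + π ^ j) ^ 2 - 1 = 2 * π ^ j + π ^ j * π ^ j := by ring
  have h2 : v (π ^ j * π ^ j) = exp (-(2 * j : ℤ)) := by
    rw [map_mul, hp, ← WithZero.exp_add]; congr 1; ring
  -- The cross term `2πʲ` has level `e + j`, which exceeds `2j` because `j < e`.
  rw [h1, Valuation.map_add_eq_of_lt_right, h2]
  rw [h2, map_mul, hp, h.two, ← WithZero.exp_add, WithZero.exp_lt_exp]
  omega

theorem map_one_add (h : IsDyadic v π e d) {j : ℕ} (hj : 0 < j) : v (1 + π ^ j) = 1 := by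
  have hp := h.map_zpow j
  rw [zpow_natCast] at hp
  have hlt : v (π ^ j) < v 1 := by
    rw [hp, map_one, ← WithZero.exp_zero, WithZero.exp_lt_exp]; omega
  rw [Valuation.map_add_eq_of_lt_left _ hlt, map_one]
end IsDyadic

/-! ### Values of the form, and pairs of variables of equal level. -/

section
variable {K : Type*} [Field K] {ι : Type*} [Fintype ι]

/-- The diagonal form with coefficients `a`, restricted to the variables in `S`, represents `c` with
one of its terms of level `l`. -/
def Represents (v : Valuation K ℤᵐ⁰) (d : ℕ) (a : ι → K) (S : Finset ι) (l : ℤ) (c : K) : Prop :=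
  ∃ x : ι → K, (∀ i ∉ S, x i = 0) ∧ ∑ i, a i * x i ^ d = c ∧ ∃ i ∈ S, v (a i * x i ^ d) = exp (-l)

/-- The variables in `S` represent an element of level at least `l + 2e` using a term of level
`l`. -/
def IsFull (v : Valuation K ℤᵐ⁰) (e d : ℕ) (a : ι → K) (S : Finset ι) (l : ℤ) : Prop :=
  ∃ c, Represents v d a S l c ∧ v c ≤ exp (-(l + 2 * e))

/-- The variables in `S` approximate every element of level `l + f` up to level `l + 2e`, using a
term of level `l`. -/
def IsHalf (v : Valuation K ℤᵐ⁰) (e d : ℕ) (a : ι → K) (S : Finset ι) (l : ℤ) (f : ℕ) : Prop :=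
  ∀ g, v g = exp (-(l + f)) → ∃ c, Represents v d a S l c ∧ v (g - c) ≤ exp (-(l + 2 * e))

namespace Represents
variable {v : Valuation K ℤᵐ⁰} {π : K} {e d : ℕ} {a : ι → K} {S T : Finset ι} {l l' k : ℤ} {c c' : K}

theorem exists_zero (hd : d ≠ 0) (h : Represents v d a S l 0) :
    ∃ x : ι → K, x ≠ 0 ∧ ∑ i, a i * x i ^ d = 0 := by
  obtain ⟨x, -, hx, i, -, hi⟩ := h
  refine ⟨x, ?_, hx⟩
  rintro rfl
  rw [Pi.zero_apply, zero_pow hd, mul_zero, map_zero] at hi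
  exact WithZero.exp_ne_zero hi.symm

theorem mul_pow (h : Represents v d a S l c) {z : K} (hz : v (z ^ d) = exp (-k)) :
    Represents v d a S (l + k) (z ^ d * c) := by
  obtain ⟨x, hS, hx, i, hi, hv⟩ := h
  refine ⟨fun i => z * x i, fun i hi => by simp [hS i hi], ?_, i, hi, ?_⟩
  · rw [← hx, Finset.mul_sum]
    exact Finset.sum_congr rfl fun i _ => by ring
  · have : a i * (z * x i) ^ d = a i * x i ^ d * z ^ d := by ring
    rw [this, map_mul, hv, hz, ← WithZero.exp_add]
    congr 1; ring

theorem shift (hD : IsDyadic v π e d) (h : Represents v d a S l c) (k : ℤ) :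
    Represents v d a S (l + k * d) ((π ^ k) ^ d * c) := by
  refine h.mul_pow ?_
  rw [map_pow, hD.map_zpow, ← WithZero.exp_nsmul]
  congr 1; simp; ring

theorem add_of_le (hd : d ≠ 0) [DecidableEq ι] (h : Represents v d a S l c)
    (h' : Represents v d a T l' c') (hST : Disjoint S T) : Represents v d a (S ∪ T) l (c + c') := by
  obtain ⟨x, hS, hx, i, hi, hv⟩ := h
  obtain ⟨y, hT, hy, -⟩ := h'
  refine ⟨fun i => x i + y i, fun i hi => ?_, ?_, i, Finset.mem_union_left _ hi, ?_⟩
  · rw [Finset.mem_union, not_or] at hi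
    simp [hS i hi.1, hT i hi.2]
  · rw [← hx, ← hy, ← Finset.sum_add_distrib]
    refine Finset.sum_congr rfl fun i _ => ?_
    by_cases hi : i ∈ S
    · simp [hT i (Finset.disjoint_left.1 hST hi), hd]
    · simp [hS i hi, hd]
  · simpa [hT i (Finset.disjoint_left.1 hST hi)] using hv

/-- The error is absorbed into the term `t` of level `l`: the factor `1 + δ / t` is close enough to
`1` to be a `d`-th power. -/
theorem perturb (hD : IsDyadic v π e d) (h : Represents v d a S l c) {δ : K}
    (hδ : v δ < exp (-(l + 2 * e))) : Represents v d a S l (c + δ) := by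
  classical
  obtain ⟨x, hS, hx, i, hi, hv⟩ := h
  set t := a i * x i ^ d
  have ht : t ≠ 0 := fun h => WithZero.exp_ne_zero (by rw [← hv, h, map_zero])
  have hlt : v (1 + δ / t - 1) < exp (-(2 * e : ℤ)) := by
    rw [add_sub_cancel_left, map_div₀, hv, div_lt_iff₀ (by simp), ← WithZero.exp_add]
    convert hδ using 2; ring
  obtain ⟨y, hy⟩ := hD.near_one _ hlt
  have hty : a i * (x i * y) ^ d = t + δ := by
    rw [_root_.mul_pow, ← mul_assoc, hy]
    change t * _ = _
    field_simp
  refine ⟨Function.update x i (x i * y), fun j hj => ?_, ?_, i, hi, ?_⟩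
  · rw [Function.update_of_ne (by rintro rfl; exact hj hi)]
    exact hS j hj
  · rw [← hx, ← Finset.add_sum_erase _ _ (Finset.mem_univ i),
      ← Finset.add_sum_erase _ (fun i => a i * x i ^ d) (Finset.mem_univ i)]
    simp only [Function.update_self, hty]
    rw [Finset.sum_congr rfl fun j hj => by
      rw [Function.update_of_ne (Finset.ne_of_mem_erase hj)]]
    ring
  · rw [Function.update_self, hty, Valuation.map_add_eq_of_lt_left, hv]
    rw [hv]
    refine hδ.trans_le ?_
    rw [WithZero.exp_le_exp]; omega

theorem exists_zero_of_lt (hd : d ≠ 0) (hD : IsDyadic v π e d) (h : Represents v d a S l c)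
    (hc : v c < exp (-(l + 2 * e))) : ∃ x : ι → K, x ≠ 0 ∧ ∑ i, a i * x i ^ d = 0 := by
  have := h.perturb hD (δ := -c) (by rwa [Valuation.map_neg])
  rw [add_neg_cancel] at this
  exact this.exists_zero hd

theorem single (hd : d ≠ 0) {i : ι} (hi : v (a i) = exp (-l)) : Represents v d a {i} l (a i) := by
  classical
  refine ⟨Pi.single i 1, fun j hj => ?_, ?_, i, by simp, by simpa using hi⟩
  · rw [Pi.single_eq_of_ne (by simpa using hj)]
  · rw [Finset.sum_eq_single i]
    · simp
    · intro j _ hj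
      simp [Pi.single_eq_of_ne hj, hd]
    · simp

theorem pair (hd : d ≠ 0) (hD : IsDyadic v π e d) [DecidableEq ι] {i j : ι} (hij : i ≠ j)
    (hi : v (a i) = exp (-l)) (hj : v (a j) = exp (-l)) {x y : K} (hx : v x = 1) (hy : v y = 1) :
    Represents v d a {i, j} l (a i * x ^ 2 + a j * y ^ 2) := by
  obtain ⟨z, hz⟩ := hD.sq x hx
  obtain ⟨w, hw⟩ := hD.sq y hy
  have h1 := (single (v := v) hd hi).mul_pow (z := z) (k := 0) (by rw [hz, map_pow, hx]; simp)
  have h2 := (single (v := v) hd hj).mul_pow (z := w) (k := 0) (by rw [hw, map_pow, hy]; simp)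
  have := h1.add_of_le hd h2 (by simpa using hij)
  rw [hz, hw, add_zero] at this
  rwa [Finset.insert_eq, mul_comm (a i), mul_comm (a j)]
end Represents

variable {v : Valuation K ℤᵐ⁰} {π : K} {e d : ℕ} {a : ι → K} {S T : Finset ι} {l l' k : ℤ}

theorem IsFull.shift (hD : IsDyadic v π e d) (h : IsFull v e d a S l) (k : ℤ) :
    IsFull v e d a S (l + k * d) := by
  obtain ⟨c, hc, hv⟩ := h
  refine ⟨_, hc.shift hD k, ?_⟩
  rw [map_mul, map_pow, hD.map_zpow, ← WithZero.exp_nsmul]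
  refine (mul_le_mul_right hv _).trans ?_
  rw [← WithZero.exp_add, WithZero.exp_le_exp]
  simp; linarith

theorem IsHalf.shift (hD : IsDyadic v π e d) {f : ℕ} (h : IsHalf v e d a S l f) (k : ℤ) :
    IsHalf v e d a S (l + k * d) f := by
  intro g hg
  have hz : v ((π ^ k) ^ d) = exp (-(k * d)) := by
    rw [map_pow, hD.map_zpow, ← WithZero.exp_nsmul]
    congr 1; simp; ring
  have hz0 : (π ^ k) ^ d ≠ 0 := pow_ne_zero _ (zpow_ne_zero _ hD.pi_ne_zero)
  obtain ⟨c, hc, hv⟩ := h (g / (π ^ k) ^ d) (by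
    rw [map_div₀, hg, hz, ← WithZero.exp_sub]; congr 1; ring)
  refine ⟨_, hc.shift hD k, ?_⟩
  have : g - (π ^ k) ^ d * c = (π ^ k) ^ d * (g / (π ^ k) ^ d - c) := by field_simp
  rw [this, map_mul, hz]
  refine (mul_le_mul_right hv _).trans ?_
  rw [← WithZero.exp_add, WithZero.exp_le_exp]
  linarith

/-- Multiplying `y` by `1 + πʲ` changes `aᵢ + aⱼy²` at level `l + 2j`, so an even offset from `l`
can always be cancelled. The climb to `l + 2e` stops only at an odd offset `f`, and this oddness is
what makes the pair half. -/
theorem isFull_or_isHalf_pair (hd : d ≠ 0) (hD : IsDyadic v π e d) [DecidableEq ι] {i j : ι}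
    (hij : i ≠ j) (hi : v (a i) = exp (-l)) (hj : v (a j) = exp (-l)) :
    IsFull v e d a {i, j} l ∨ ∃ f < 2 * e, IsHalf v e d a {i, j} l f := by
  have key : ∀ h : ℕ, h < 2 * e → (∃ y, v y = 1 ∧ v (a i + a j * y ^ 2) ≤ exp (-(l + h + 1))) ∨
      ∃ f < 2 * e, Odd f ∧ ∃ y, v y = 1 ∧ v (a i + a j * y ^ 2) = exp (-(l + f)) := by
    intro h
    induction h with
    | zero =>
      intro _
      refine Or.inl ⟨1, map_one _, ?_⟩
      have := hD.map_add_lt hi hj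
      rw [WithZero.lt_exp_iff_le_exp_sub_one] at this
      convert this using 2
      · simp
      · push_cast; ring
    | succ h ih =>
      intro hh
      obtain ⟨y, hy, hv⟩ | h' := ih (by omega)
      swap
      · exact Or.inr h'
      by_cases hlt : v (a i + a j * y ^ 2) ≤ exp (-(l + (h + 1 : ℕ) + 1))
      · exact Or.inl ⟨y, hy, hlt⟩
      have heq : v (a i + a j * y ^ 2) = exp (-(l + (h + 1 : ℕ))) := by
        refine le_antisymm (by convert hv using 2; push_cast; ring) ?_
        by_contra hcon
        rw [not_le, WithZero.lt_exp_iff_le_exp_sub_one] at hcon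
        exact hlt (by convert hcon using 2; ring)
      rcases Nat.even_or_odd' (h + 1) with ⟨j', hj' | hj'⟩
      · left
        have hje : j' < e := by omega
        refine ⟨y * (1 + π ^ j'), by rw [map_mul, hy, hD.map_one_add (by omega), one_mul], ?_⟩
        have h1 : a i + a j * (y * (1 + π ^ j')) ^ 2 =
            (a i + a j * y ^ 2) + a j * y ^ 2 * ((1 + π ^ j') ^ 2 - 1) := by ring
        have h2 : v (a j * y ^ 2 * ((1 + π ^ j') ^ 2 - 1)) = exp (-(l + (h + 1 : ℕ))) := by
          rw [map_mul, map_mul, map_pow, hy, hj, hD.map_one_add_sq_sub_one hje, one_pow, mul_one,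
            ← WithZero.exp_add, hj']
          congr 1; push_cast; ring
        have := hD.map_add_lt heq h2
        rw [h1]
        rw [WithZero.lt_exp_iff_le_exp_sub_one] at this
        convert this using 2; ring
      · exact Or.inr ⟨h + 1, hh, ⟨j', hj'⟩, y, hy, heq⟩
  have he := hD.one_le
  obtain ⟨y, hy, hv⟩ | ⟨f, hf, hodd, y, hy, hv⟩ := key (2 * e - 1) (by omega)
  · left
    have := Represents.pair hd hD hij hi hj (x := 1) (y := y) (map_one _) hy
    rw [one_pow, mul_one] at this
    refine ⟨_, this, hv.trans ?_⟩
    rw [WithZero.exp_le_exp]; omega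
  refine Or.inr ⟨f, hf, fun g hg => ?_⟩
  -- Corrections at every level past `l + f` are available: scaling both variables moves the value
  -- at `l + f + 2j`, and scaling `y` alone at `l + 2j`, which has the other parity since `f` is
  -- odd.
  have key2 : ∀ h : ℕ, f + h < 2 * e → ∃ x y, v x = 1 ∧ v y = 1 ∧
      v (g - (a i * x ^ 2 + a j * y ^ 2)) ≤ exp (-(l + f + h + 1)) := by
    intro h
    induction h with
    | zero =>
      intro _
      refine ⟨1, y, map_one _, hy, ?_⟩
      have := hD.map_sub_lt hg hv
      rw [WithZero.lt_exp_iff_le_exp_sub_one] at this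
      rw [one_pow, mul_one]
      convert this using 2
      push_cast; ring
    | succ h ih =>
      intro hh
      obtain ⟨x, y, hx, hy, hv⟩ := ih (by omega)
      by_cases hlt : v (g - (a i * x ^ 2 + a j * y ^ 2)) ≤ exp (-(l + f + (h + 1 : ℕ) + 1))
      · exact ⟨x, y, hx, hy, hlt⟩
      have heq : v (g - (a i * x ^ 2 + a j * y ^ 2)) = exp (-(l + f + (h + 1 : ℕ))) := by
        refine le_antisymm (by convert hv using 2; push_cast; ring) ?_
        by_contra hcon
        rw [not_le, WithZero.lt_exp_iff_le_exp_sub_one] at hcon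
        exact hlt (by convert hcon using 2; ring)
      obtain ⟨q, hq⟩ := hodd
      rcases Nat.even_or_odd' (h + 1) with ⟨j', hj' | hj'⟩
      · have hje : j' < e := by omega
        have hu : v (1 + π ^ j') = 1 := hD.map_one_add (by omega)
        refine ⟨x * (1 + π ^ j'), y * (1 + π ^ j'), by rw [map_mul, hx, hu, one_mul],
          by rw [map_mul, hy, hu, one_mul], ?_⟩
        have hc : v (a i * x ^ 2 + a j * y ^ 2) = exp (-(l + f)) := by
          rw [← hg]
          refine (Valuation.map_eq_of_sub_lt v ?_)
          rw [← Valuation.map_neg, neg_sub, heq, hg, WithZero.exp_lt_exp]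
          push_cast; omega
        have h1 : g - (a i * (x * (1 + π ^ j')) ^ 2 + a j * (y * (1 + π ^ j')) ^ 2) =
            (g - (a i * x ^ 2 + a j * y ^ 2)) -
              (a i * x ^ 2 + a j * y ^ 2) * ((1 + π ^ j') ^ 2 - 1) := by ring
        have h2 : v ((a i * x ^ 2 + a j * y ^ 2) * ((1 + π ^ j') ^ 2 - 1)) =
            exp (-(l + f + (h + 1 : ℕ))) := by
          rw [map_mul, hc, hD.map_one_add_sq_sub_one hje, ← WithZero.exp_add, hj']
          congr 1; push_cast; ring
        have := hD.map_sub_lt heq h2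
        rw [h1]
        rw [WithZero.lt_exp_iff_le_exp_sub_one] at this
        convert this using 2; ring
      · have hje : q + j' + 1 < e := by omega
        refine ⟨x, y * (1 + π ^ (q + j' + 1)), hx,
          by rw [map_mul, hy, hD.map_one_add (by omega), one_mul], ?_⟩
        have h1 : g - (a i * x ^ 2 + a j * (y * (1 + π ^ (q + j' + 1))) ^ 2) =
            (g - (a i * x ^ 2 + a j * y ^ 2)) -
              a j * y ^ 2 * ((1 + π ^ (q + j' + 1)) ^ 2 - 1) := by ring
        have h2 : v (a j * y ^ 2 * ((1 + π ^ (q + j' + 1)) ^ 2 - 1)) =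
            exp (-(l + f + (h + 1 : ℕ))) := by
          rw [map_mul, map_mul, map_pow, hy, hj, hD.map_one_add_sq_sub_one hje, one_pow, mul_one,
            ← WithZero.exp_add, hj', hq]
          congr 1; push_cast; ring
        have := hD.map_sub_lt heq h2
        rw [h1]
        rw [WithZero.lt_exp_iff_le_exp_sub_one] at this
        convert this using 2; ring
  obtain ⟨x, y, hx, hy, hv⟩ := key2 (2 * e - 1 - f) (by omega)
  refine ⟨_, Represents.pair hd hD hij hi hj hx hy, hv.trans ?_⟩
  rw [WithZero.exp_le_exp]; omega
end

/-! ### Combining disjoint full and half sets. -/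

section
variable {K : Type*} [Field K] {ι : Type*} [Fintype ι] [DecidableEq ι]
  {v : Valuation K ℤᵐ⁰} {π : K} {e d : ℕ} {a : ι → K} {S T : Finset ι} {l l' k : ℤ} {f f' : ℕ}

theorem exists_zero_of_isFull_of_isFull (hd : d ≠ 0) (hD : IsDyadic v π e d)
    (hS : IsFull v e d a S l) (hT : IsFull v e d a T l) (hST : Disjoint S T) :
    ∃ x : ι → K, x ≠ 0 ∧ ∑ i, a i * x i ^ d = 0 := by
  obtain ⟨c, hc, hv⟩ := hS
  obtain ⟨c', hc', hv'⟩ := hT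
  by_cases h : v c < exp (-(l + 2 * e))
  · exact hc.exists_zero_of_lt hd hD h
  by_cases h' : v c' < exp (-(l + 2 * e))
  · exact hc'.exists_zero_of_lt hd hD h'
  refine (hc.add_of_le hd hc' hST).exists_zero_of_lt hd hD (hD.map_add_lt ?_ ?_)
  · exact le_antisymm hv (not_lt.1 h)
  · exact le_antisymm hv' (not_lt.1 h')

theorem exists_zero_of_isFull_of_notMem (hd : d ≠ 0) (hD : IsDyadic v π e d)
    (hS : IsFull v e d a S l) {i : ι} (hi : i ∉ S) (hv : v (a i) = exp (-l'))
    (hk : l' = l + 2 * e + k * d) : ∃ x : ι → K, x ≠ 0 ∧ ∑ i, a i * x i ^ d = 0 := by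
  obtain ⟨c, hc, hc'⟩ := hS.shift hD k
  by_cases h : v c < exp (-(l + k * d + 2 * e))
  · exact hc.exists_zero_of_lt hd hD h
  refine (hc.add_of_le hd (.single hd hv) (by simpa using hi)).exists_zero_of_lt hd hD
    (hD.map_add_lt (le_antisymm hc' (not_lt.1 h)) ?_)
  rw [hv, hk]
  congr 1; ring

/-- `S` produces an element of the common target level and `T` cancels it. The precision is that of
`T` while the recorded term comes from `S`: `l < l'` yields a zero, `l = l'` a full set. -/
theorem IsHalf.isFull_union (hd : d ≠ 0) (hD : IsDyadic v π e d) (hS : IsHalf v e d a S l f)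
    (hT : IsHalf v e d a T l' f') (hf : f < 2 * e) (hST : Disjoint S T)
    (heq : l + f = l' + f') :
    ∃ c, Represents v d a (S ∪ T) l c ∧ v c ≤ exp (-(l' + 2 * e)) := by
  obtain ⟨c, hc, hv⟩ := hS (π ^ (l + f)) (hD.map_zpow _)
  have hvc : v c = exp (-(l + f)) := by
    rw [← hD.map_zpow (l + f)]
    refine Valuation.map_eq_of_sub_lt v ?_
    rw [← Valuation.map_neg, neg_sub, hD.map_zpow]
    refine hv.trans_lt ?_
    rw [WithZero.exp_lt_exp]; omega
  obtain ⟨c', hc', hv'⟩ := hT (-c) (by rw [Valuation.map_neg, hvc, heq])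
  refine ⟨c + c', hc.add_of_le hd hc' hST, ?_⟩
  rw [← Valuation.map_neg]
  convert hv' using 2; ring

theorem IsHalf.exists_zero_of_lt (hd : d ≠ 0) (hD : IsDyadic v π e d) (hS : IsHalf v e d a S l f)
    (hT : IsHalf v e d a T l' f') (hf : f < 2 * e) (hST : Disjoint S T)
    (hl : l < l') (heq : l + f = l' + f') : ∃ x : ι → K, x ≠ 0 ∧ ∑ i, a i * x i ^ d = 0 := by
  obtain ⟨c, hc, hv⟩ := hS.isFull_union hd hD hT hf hST heq
  refine hc.exists_zero_of_lt hd hD (hv.trans_lt ?_)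
  rw [WithZero.exp_lt_exp]; omega

theorem IsHalf.exists_zero_or_isFull (hd : d ≠ 0) (hD : IsDyadic v π e d)
    (hS : IsHalf v e d a S l f) (hT : IsHalf v e d a T l' f') (hf : f < 2 * e) (hf' : f' < 2 * e)
    (hST : Disjoint S T) (heq : l + f = l' + f' + k * d) :
    (∃ x : ι → K, x ≠ 0 ∧ ∑ i, a i * x i ^ d = 0) ∨
      (l = l' + k * d ∧ IsFull v e d a (S ∪ T) l) := by
  have hT' := hT.shift hD k
  rcases lt_trichotomy l (l' + k * d) with h | h | h
  · exact Or.inl (hS.exists_zero_of_lt hd hD hT' hf hST h (by rw [heq]; ring))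
  · refine Or.inr ⟨h, ?_⟩
    have := hS.isFull_union hd hD hT' hf hST (by rw [heq]; ring)
    rwa [← h] at this
  · exact Or.inl (hT'.exists_zero_of_lt hd hD hS hf' hST.symm h (by rw [heq]; ring))
end

/-! ### Counting variables by level modulo `d`. -/

theorem sum_le_of_forall_le {G : Type*} [AddCommGroup G] [Fintype G] [DecidableEq G] (t : G)
    {n q : G → ℕ} (hq : ∑ g, q g ≤ Fintype.card G) (h1 : ∀ g, n g ≤ 2 * q g + 5)
    (h2 : ∀ g, t ≠ 0 → n (g + t) ≠ 0 → n g ≤ 2 * q g + 1)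
    (h3 : ∀ g, t = 0 → n g ≤ 2 * q g + 2) : 2 * ∑ g, n g ≤ 9 * Fintype.card G := by
  by_cases ht : t = 0
  · have : ∑ g, n g ≤ ∑ g, (2 * q g + 2) := Finset.sum_le_sum fun g _ => h3 g ht
    rw [Finset.sum_add_distrib, ← Finset.mul_sum, Finset.sum_const, Finset.card_univ,
      smul_eq_mul] at this
    omega
  · set z : G → ℕ := fun g => if n g = 0 then 1 else 0
    -- The surplus allowed at `g` when `g + t` is empty is charged to that empty level; the `z`
    -- terms cancel on summing because translation by `t` is a bijection.
    have key : ∀ g, 2 * n g + 5 * z g ≤ 4 * q g + 5 + 5 * z (g + t) := by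
      intro g
      have := h1 g
      have := h2 g ht
      simp only [z]
      split_ifs <;> omega
    have hz : ∑ g, z (g + t) = ∑ g, z g := Equiv.sum_comp (Equiv.addRight t) z
    have := Finset.sum_le_sum (s := Finset.univ) fun g _ => key g
    simp only [Finset.sum_add_distrib, ← Finset.mul_sum, Finset.sum_const, Finset.card_univ,
      smul_eq_mul, hz] at this
    omega

section
variable {K : Type*} [Field K] {ι : Type*} [Fintype ι] [DecidableEq ι]
  {v : Valuation K ℤᵐ⁰} {π : K} {e d : ℕ} {a : ι → K}

open scoped Classical in
/-- The levels modulo `d` at which pairs of variables of level `g` represent elements. -/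
noncomputable def pairTargets (v : Valuation K ℤᵐ⁰) (e d : ℕ) [NeZero d] (a : ι → K)
    (lev : ι → ZMod d) (g : ZMod d) : Finset (ZMod d) :=
  {b | ∃ i j, i ≠ j ∧ lev i = g ∧ lev j = g ∧ ∃ f < 2 * e,
    IsHalf v e d a {i, j} g.val f ∧ b = g + f}

theorem ZMod.exists_val_add_eq {d : ℕ} [NeZero d] {g g' : ZMod d} {f f' : ℕ}
    (h : g + f = g' + f') : ∃ k : ℤ, (g.val : ℤ) + f = g'.val + f' + k * d := by
  have : (((g.val : ℤ) + f : ℤ) : ZMod d) = ((g'.val + f' : ℤ) : ZMod d) := by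
    push_cast
    simpa using h
  rw [ZMod.intCast_eq_intCast_iff_dvd_sub, ← dvd_neg, neg_sub] at this
  obtain ⟨k, hk⟩ := this
  exact ⟨k, by linarith⟩

/-- Pigeonhole: with `q` targets available, `q + 1` disjoint pairs contain a full pair or two half
pairs with a common target, whose union is full. The bound `4` on the size lets a second full set be
extracted afterwards. -/
theorem exists_isFull_of_card_le [NeZero d] (hD : IsDyadic v π e d) {lev : ι → ZMod d}
    (hlev : ∀ i, v (a i) = exp (-((lev i).val : ℤ)))
    (hz : ¬∃ x : ι → K, x ≠ 0 ∧ ∑ i, a i * x i ^ d = 0) {g : ZMod d} {A : Finset ι}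
    (hA : ∀ i ∈ A, lev i = g) (hcard : 2 * (pairTargets v e d a lev g).card + 2 ≤ A.card) :
    ∃ S ⊆ A, S.card ≤ 4 ∧ IsFull v e d a S g.val := by
  have hd : d ≠ 0 := NeZero.ne d
  set q := (pairTargets v e d a lev g).card
  obtain ⟨φ⟩ : Nonempty (Fin (q + 1) × Bool ↪ A) := by
    rw [Function.Embedding.nonempty_iff_card_le]
    simp; omega
  have hvA : ∀ i ∈ A, v (a i) = exp (-(g.val : ℤ)) := fun i hi => by rw [hlev, hA i hi]
  let S : Fin (q + 1) → Finset ι := fun r => {(φ (r, false) : ι), (φ (r, true) : ι)}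
  have hSA : ∀ r, S r ⊆ A := fun r => by
    simp [S, Finset.insert_subset_iff]
  have hS2 : ∀ r, (S r).card ≤ 2 := fun r => Finset.card_le_two
  have hne : ∀ r, (φ (r, false) : ι) ≠ φ (r, true) := fun r h => by
    have := φ.injective (Subtype.ext h)
    simp at this
  have hdisj : ∀ r r', r ≠ r' → Disjoint (S r) (S r') := fun r r' hrr => by
    have hφ : ∀ b b', (φ (r, b) : ι) ≠ φ (r', b') := fun b b' h =>
      hrr (congrArg Prod.fst (φ.injective (Subtype.ext h)))
    simp [S, (hφ _ _).symm]
  by_contra hcon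
  push Not at hcon
  have hhalf : ∀ r, ∃ f < 2 * e, IsHalf v e d a (S r) g.val f := fun r =>
    (isFull_or_isHalf_pair hd hD (hne r) (hvA _ (φ _).2) (hvA _ (φ _).2)).resolve_left
      (hcon _ (hSA r) ((hS2 r).trans (by norm_num)))
  choose f hf hhalf using hhalf
  obtain ⟨r, -, r', -, hrr, heq⟩ := Finset.exists_ne_map_eq_of_card_lt_of_maps_to
    (s := Finset.univ) (t := pairTargets v e d a lev g) (f := fun r => g + (f r : ZMod d))
    (by simp [q]) (fun r _ => by
      simp only [pairTargets, Finset.coe_filter, Finset.mem_univ, true_and, Set.mem_ofPred_eq]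
      exact ⟨_, _, hne r, hA _ (φ _).2, hA _ (φ _).2, f r, hf r, hhalf r, rfl⟩)
  obtain ⟨k, hk⟩ := ZMod.exists_val_add_eq heq
  rcases (hhalf r).exists_zero_or_isFull hd hD (hhalf r') (hf r) (hf r') (hdisj r r' hrr) hk
    with h | ⟨-, h⟩
  · exact hz h
  · refine hcon _ (Finset.union_subset (hSA r) (hSA r')) ?_ h
    have := Finset.card_union_le (S r) (S r')
    have := hS2 r
    have := hS2 r'
    omega

/-- A target shared by two different levels would give a zero, so the target sets are disjoint in
`ZMod d`. -/
theorem sum_card_pairTargets_le [NeZero d] (hD : IsDyadic v π e d) {lev : ι → ZMod d}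
    (hz : ¬∃ x : ι → K, x ≠ 0 ∧ ∑ i, a i * x i ^ d = 0) :
    ∑ g, (pairTargets v e d a lev g).card ≤ Fintype.card (ZMod d) := by
  rw [← Finset.card_biUnion]
  · exact Finset.card_le_univ _
  intro g _ g' _ hgg
  rw [Function.onFun, Finset.disjoint_left]
  intro b hb hb'
  simp only [pairTargets, Finset.mem_filter, Finset.mem_univ, true_and] at hb hb'
  obtain ⟨i, j, -, hi, hj, f, hf, hhalf, rfl⟩ := hb
  obtain ⟨i', j', -, hi', hj', f', hf', hhalf', heq⟩ := hb'
  obtain ⟨k, hk⟩ := ZMod.exists_val_add_eq heq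
  have hdisj : Disjoint ({i, j} : Finset ι) {i', j'} := by
    rw [Finset.disjoint_left]
    intro x hx hx'
    have h1 : lev x = g := by
      rcases Finset.mem_insert.1 hx with rfl | hx
      · exact hi
      · rwa [Finset.mem_singleton.1 hx]
    have h2 : lev x = g' := by
      rcases Finset.mem_insert.1 hx' with rfl | hx'
      · exact hi'
      · rwa [Finset.mem_singleton.1 hx']
    exact hgg (h1.symm.trans h2)
  rcases hhalf.exists_zero_or_isFull (NeZero.ne d) hD hhalf' hf hf' hdisj hk with h | ⟨h, -⟩
  · exact hz h
  · apply hgg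
    have := congrArg (Int.cast : ℤ → ZMod d) h
    simpa using this

theorem two_mul_card_le_of_no_zero [NeZero d] (hD : IsDyadic v π e d) {lev : ι → ZMod d}
    (hlev : ∀ i, v (a i) = exp (-((lev i).val : ℤ)))
    (hz : ¬∃ x : ι → K, x ≠ 0 ∧ ∑ i, a i * x i ^ d = 0) : 2 * Fintype.card ι ≤ 9 * d := by
  have hd : d ≠ 0 := NeZero.ne d
  set A : ZMod d → Finset ι := fun g => {i | lev i = g}
  have hA : ∀ g, ∀ i ∈ A g, lev i = g := fun g i hi => (Finset.mem_filter.1 hi).2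
  have hsum : ∑ g, (A g).card = Fintype.card ι :=
    (Finset.card_eq_sum_card_fiberwise (fun i _ => Finset.mem_univ (lev i))).symm
  have hvar : ∀ (g : ZMod d) (S : Finset ι), IsFull v e d a S g.val →
      ∀ i, lev i = g + (2 * e : ℕ) → i ∈ S := by
    intro g S hS i hi
    by_contra hiS
    obtain ⟨k, hk⟩ := ZMod.exists_val_add_eq (g := lev i) (g' := g) (f := 0) (f' := 2 * e)
      (by simpa using hi)
    exact hz (exists_zero_of_isFull_of_notMem hd hD hS hiS (hlev i) (k := k)
      (by push_cast at hk; linarith))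
  rw [← hsum]
  conv_rhs => rw [← ZMod.card d]
  refine sum_le_of_forall_le ((2 * e : ℕ) : ZMod d) (sum_card_pairTargets_le hD (lev := lev) hz)
    (fun g => ?_) (fun g ht hn => ?_) (fun g ht => ?_) <;> by_contra! hcon
  -- From `2q + 6` variables, removing at most `4` leaves the `2q + 2` needed for a second, disjoint
  -- full set.
  · obtain ⟨S, hSA, hS4, hS⟩ := exists_isFull_of_card_le hD hlev hz (hA g) (by omega)
    obtain ⟨T, hTA, -, hT⟩ := exists_isFull_of_card_le hD hlev hz (A := A g \ S)
      (fun i hi => hA g i (Finset.mem_sdiff.1 hi).1) (by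
        rw [Finset.card_sdiff_of_subset hSA]; omega)
    exact hz (exists_zero_of_isFull_of_isFull hd hD hS hT
      (Finset.disjoint_of_subset_right hTA Finset.disjoint_sdiff))
  · obtain ⟨S, hSA, -, hS⟩ := exists_isFull_of_card_le hD hlev hz (hA g) (by omega)
    obtain ⟨i, hi⟩ := Finset.card_ne_zero.1 hn
    have h1 := hA g i (hSA (hvar g S hS i (hA _ i hi)))
    have h2 := hA _ i hi
    rw [h1] at h2
    exact ht (by simpa using h2)
  · obtain ⟨i, hi⟩ := Finset.card_ne_zero.1 (show (A g).card ≠ 0 by omega)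
    obtain ⟨S, hSA, -, hS⟩ := exists_isFull_of_card_le hD hlev hz (A := (A g).erase i)
      (fun j hj => hA g j (Finset.mem_of_mem_erase hj)) (by
        rw [Finset.card_erase_of_mem hi]; omega)
    exact Finset.notMem_erase i (A g) (hSA (hvar g S hS i (by rw [ht, add_zero, hA g i hi])))
end

/-! ### Normalisation of the coefficients and the final bound. -/

theorem IsDyadic.hasNontrivialZero {K : Type*} [Field K] {v : Valuation K ℤᵐ⁰} {π : K} {e d s : ℕ}
    [NeZero d] (hD : IsDyadic v π e d) (hs : 9 * d < 2 * s) (a : Fin s → K) :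
    HasNontrivialZero d a := by
  have hd : d ≠ 0 := NeZero.ne d
  by_cases h0 : ∃ i, a i = 0
  · obtain ⟨i, hi⟩ := h0
    refine ⟨Pi.single i 1, by simp, Finset.sum_eq_zero fun j _ => ?_⟩
    by_cases hj : j = i
    · simp [hj, hi]
    · simp [Pi.single_eq_of_ne hj, hd]
  push Not at h0
  have hl : ∀ i, ∃ n : ℤ, v (a i) = exp (-n) := fun i =>
    ⟨-WithZero.log (v (a i)), by rw [neg_neg, WithZero.exp_log ((v.ne_zero_iff).2 (h0 i))]⟩
  choose n hn using hl
  have hdiv : ∀ i, ∃ k : ℤ, n i = ((n i : ZMod d).val : ℤ) + k * d := fun i => by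
    have : ((n i : ℤ) : ZMod d) = (((n i : ZMod d).val : ℤ) : ZMod d) := by simp
    rw [ZMod.intCast_eq_intCast_iff_dvd_sub, ← dvd_neg, neg_sub] at this
    obtain ⟨k, hk⟩ := this
    exact ⟨k, by linarith⟩
  choose k hk using hdiv
  by_contra hz
  -- Rescaling the variables by powers of `π` brings every coefficient to a level in `[0, d)`.
  have := two_mul_card_le_of_no_zero hD (a := fun i => a i * (π ^ (-k i)) ^ d)
    (lev := fun i => (n i : ZMod d)) (fun i => by
      rw [map_mul, hn, map_pow, hD.map_zpow, ← WithZero.exp_nsmul, ← WithZero.exp_add]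
      congr 1
      rw [nsmul_eq_mul]
      linarith [hk i]) (by
      rintro ⟨x, hx, hsum⟩
      refine hz ⟨fun i => π ^ (-k i) * x i, fun h => hx ?_, ?_⟩
      · funext i
        have := congrFun h i
        exact (mul_eq_zero.1 this).resolve_left (zpow_ne_zero _ hD.pi_ne_zero)
      · rw [← hsum]
        exact Finset.sum_congr rfl fun i _ => by ring)
  rw [Fintype.card_fin] at this
  omega

theorem IsTotallyRamified.exists_isDyadic {K : Type*} [Field K] [Algebra ℚ_[2] K]
    [FiniteDimensional ℚ_[2] K] [Algebra ℤ_[2] K] [IsScalarTower ℤ_[2] ℚ_[2] K]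
    (hK : IsTotallyRamified 2 K) {m : ℕ} (hm : Odd m) :
    ∃ (v : Valuation K ℤᵐ⁰) (π : K) (e : ℕ), IsDyadic v π e (2 * m) := by
  have : CharZero K := charZero_of_injective_algebraMap (algebraMap ℚ_[2] K).injective
  obtain ⟨v, ⟨π, hπ⟩, hres, hsq, hpow⟩ := hK.exists_valuation
  have h2 : v 2 ≤ 1 := by
    have := v.map_add 1 1
    rwa [one_add_one_eq_two, max_self, map_one] at this
  obtain ⟨e, he⟩ : ∃ e : ℕ, v 2 = exp (-(e : ℤ)) := by
    have h0 : v 2 ≠ 0 := v.ne_zero_iff.2 two_ne_zero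
    refine ⟨(-WithZero.log (v 2)).toNat, ?_⟩
    have : WithZero.log (v 2) ≤ 0 := by
      exact WithZero.log_one (M := ℤ) ▸ (WithZero.log_le_log h0 one_ne_zero).2 h2
    rw [Int.toNat_of_nonneg (by omega), neg_neg, WithZero.exp_log h0]
  have hunit : ∀ x y : K, ∀ n : ℕ, n ≠ 0 → y ^ n = x → v x = 1 → v y = 1 := by
    rintro x y n hn rfl h
    rw [map_pow] at h
    exact (pow_eq_one_iff_of_nonneg zero_le hn).1 h
  have h4 : v 4 = exp (-(2 * e : ℤ)) := by
    have : (4 : K) = 2 ^ 2 := by norm_num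
    rw [this, map_pow, he, ← WithZero.exp_nsmul]
    congr 1; simp
  refine ⟨v, π, e, hπ, hres, he, fun x hx => ?_, fun x hx => ?_⟩
  · obtain ⟨y, rfl⟩ := hpow m hm x hx
    exact ⟨y, by ring⟩
  · obtain ⟨y, rfl⟩ := hsq x (h4 ▸ hx)
    have h1 : v (y ^ 2) = 1 := by
      rw [← map_one v]
      refine Valuation.map_eq_of_sub_lt v (hx.trans_le ?_)
      rw [map_one, ← WithZero.exp_zero, WithZero.exp_le_exp]
      omega
    obtain ⟨z, rfl⟩ := hpow m hm y (hunit _ y 2 two_ne_zero rfl h1)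
    exact ⟨z, by ring⟩

theorem theorem1 (m d : ℕ) (hm : Odd m) (hm3 : 3 ≤ m) (hd : d = 2 * m)
    (K : Type*) [Field K] [Algebra ℚ_[2] K] [FiniteDimensional ℚ_[2] K]
    [Algebra ℤ_[2] K] [IsScalarTower ℤ_[2] ℚ_[2] K] (hK : IsTotallyRamified 2 K) :
    (∀ s : ℕ, (d : ℚ) ^ 2 / 4 + 3 * d + 1 ≤ s → ∀ a : Fin s → K, HasNontrivialZero d a) ∧
      (∃ N : ℕ, gammaStar d K = N ∧ (N : ℚ) ≤ (d : ℚ) ^ 2 / 4 + 3 * d + 1) ∧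
      (d : ℚ) ^ 2 / 4 + 3 * d + 1 < (d : ℚ) ^ 2 + 1 := by
  subst hd
  obtain ⟨v, π, e, hD⟩ := hK.exists_isDyadic hm
  have : NeZero (2 * m) := ⟨by omega⟩
  have hB : ((2 * m : ℕ) : ℚ) ^ 2 / 4 + 3 * (2 * m : ℕ) + 1 = (m ^ 2 + 6 * m + 1 : ℕ) := by
    push_cast; ring
  have hzero : ∀ s : ℕ, m ^ 2 + 6 * m + 1 ≤ s → ∀ a : Fin s → K, HasNontrivialZero (2 * m) a :=
    -- The requirement `18m < 2(m² + 6m + 1)` reads `m² - 3m + 1 > 0`, true from `m = 3` on.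
    fun s hs a => hD.hasNontrivialZero (by nlinarith) a
  rw [hB]
  refine ⟨fun s hs => hzero s (by exact_mod_cast hs), ?_, ?_⟩
  · have hle : gammaStar (2 * m) K ≤ (m ^ 2 + 6 * m + 1 : ℕ) := iInf₂_le _ hzero
    obtain ⟨N, hN⟩ := ENat.ne_top_iff_exists.1 (hle.trans_lt (ENat.natCast_lt_top _)).ne
    refine ⟨N, hN.symm, ?_⟩
    rw [← hN] at hle
    exact_mod_cast hle
  · have : m ^ 2 + 6 * m + 1 < (2 * m) ^ 2 + 1 := by nlinarith
    exact_mod_cast this
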